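/- For $\alpha\in(0,1)$ let $\mathbf K_\alpha=b_\alpha(\mathbf U)$ be the Kanter random variable, where $\mathbf U$ is uniform on $(0,1)$ and $$b_\alpha(u)=\frac{\sin(\pi u)}{\sin^{\alpha}(\pi\alpha u)\,\sin^{1-\alpha}(\pi(1-\alpha)u)},\qquad u\in(0,1).$$ For real $p\ge 1$ let $X_{p,0}$ be the bounded real random variable whose moments are $$\mathbb E[X_{p,0}^m]=\binom{mp}{m}=\frac{\Gamma(1+mp)}{\Gamma(1+m(p-1))\,m!}\qquad (m=0,1,2,\dots).$$ For $a>0$ and $b>0$ let $\mathbf B_{a,b}$ have the Beta distribution with density $\frac{\Gamma(a+b)}{\Gamma(a)\Gamma(b)}x^{a-1}(1-x)^{b-1}$ on $(0,1)$, and let $\mathbf B_{a,0}=1$. Products of random variables are products of independent random variables, and empty products equal $1$. (i) For every $\alpha\in(0,1)$ there is exactly one law of a bounded real random variable with the moments prescribed for $X_{1/\alpha,0}$, and $$\mathbf K_\alpha\overset{d}{=}\mathbf K_{1-\alpha}\overset{d}{=}X_{1/\alpha,0}^{\alpha}.$$ (ii) Let $n>p\ge 1$ be integers, and put $q_0=0$,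 $q_p=n$ and $q_j=\sup\{i\ge 1:\ ip<jn\}$ for $1\le j\le p-1$. Then $$\mathbf K_{p/n}\overset{d}{=}\left(\frac{n^n}{p^p(n-p)^{n-p}}\ \prod_{j=0}^{p-1}\left(\prod_{i=q_j+1}^{q_{j+1}-1}\mathbf B_{\frac in,\ \frac{i-j}{n-p}-\frac in}\right)\times\prod_{j=1}^{p-1}\mathbf B_{\frac{q_j}{n},\ \frac jp-\frac{q_j}{n}}\right)^{1/n}.$$ -/

import Mathlib

open MeasureTheory ProbabilityTheory

noncomputable section

/-- The uniform distribution on the open interval `(0,1)`. -/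
def unifLaw : Measure ℝ := volume.restrict (Set.Ioo (0 : ℝ) 1)

/-- Kanter's function `b_α`. The Kanter random variable of index `α` is `b_α(U)` with `U` uniform
on `(0,1)`; we realise it as the function `b_α` on the probability space `(ℝ, unifLaw)`. -/
def kanterVar (α : ℝ) (u : ℝ) : ℝ :=
  Real.sin (Real.pi * u) /
    (Real.sin (Real.pi * α * u) ^ α * Real.sin (Real.pi * (1 - α) * u) ^ (1 - α))

/-- The generalised binomial coefficient `(np choose n)` for real `p ≥ 1`. -/
def binomialMoment (p : ℝ) (n : ℕ) : ℝ :=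
  Real.Gamma (1 + n * p) / (Real.Gamma (1 + n * (p - 1)) * (n.factorial : ℝ))

/-- `μ` is the law of the bounded random variable `X_{p,0}`: a probability measure with bounded
support whose `n`-th moment is `(np choose n)` for all `n ≥ 0`. -/
structure IsBinomialMomentLaw (p : ℝ) (μ : Measure ℝ) : Prop where
  isProb : IsProbabilityMeasure μ
  bounded : ∃ C : ℝ, ∀ᵐ x ∂μ, |x| ≤ C
  moments : ∀ n : ℕ, ∫ x, x ^ n ∂μ = binomialMoment p n

/-- The law of `B_{a,b}`: the Beta distribution if `b ≠ 0`, and the point mass at `1` (its weak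
limit as `b → 0`) if `b = 0`. -/
def betaLaw (a b : ℝ) : Measure ℝ :=
  if b = 0 then Measure.dirac 1 else betaMeasure a b

/-- The indices `q_0 = 0`, `q_p = n`, and `q_j = sup {i ≥ 1, i p < j n}` for `1 ≤ j ≤ p - 1`. -/
def qIndex (p n j : ℕ) : ℕ :=
  if j = 0 then 0 else if j = p then n else sSup {i : ℕ | 1 ≤ i ∧ i * p < j * n}

/-- The index set of the Beta factors: the pairs `(j, i)` with `0 ≤ j ≤ p - 1` and
`q_j + 1 ≤ i ≤ q_{j+1} - 1`, together with the indices `1 ≤ j ≤ p - 1`. -/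
abbrev BetaIndex (p n : ℕ) : Type :=
  (Σ j : Fin p, Finset.Ioo (qIndex p n j) (qIndex p n (j + 1))) ⊕ Finset.Ico 1 p

/-- The laws of the Beta factors. -/
def betaFactorLaw (p n : ℕ) : BetaIndex p n → Measure ℝ
  | Sum.inl ⟨j, i⟩ =>
      betaLaw ((i : ℕ) / (n : ℝ)) ((((i : ℕ) : ℝ) - (j : ℕ)) / ((n : ℝ) - p) - (i : ℕ) / (n : ℝ))
  | Sum.inr j =>
      betaLaw (qIndex p n j / (n : ℝ)) ((j : ℕ) / (p : ℝ) - qIndex p n j / (n : ℝ))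

/-- The joint law of the Beta factors, which are independent. -/
def betaFactorsJointLaw (p n : ℕ) : Measure (BetaIndex p n → ℝ) :=
  Measure.pi (betaFactorLaw p n)

/-- The `1/n`-th power of the constant `n^n / (p^p (n-p)^(n-p))` times the product of all the Beta
factors, as a function of the vector `b` of these factors. -/
def betaProductRoot (p n : ℕ) (b : BetaIndex p n → ℝ) : ℝ :=
  ((n : ℝ) ^ n / ((p : ℝ) ^ p * ((n : ℝ) - p) ^ (n - p))
      * (∏ j : Fin p, ∏ i : Finset.Ioo (qIndex p n j) (qIndex p n (j + 1)), b (Sum.inl ⟨j, i⟩))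
      * ∏ j : Finset.Ico 1 p, b (Sum.inr j)) ^ (1 / (n : ℝ))

end

/-! ### Contour integrals of `(1 + w) ^ a / w ^ m` along an arc in the upper half plane. -/

section

open Set Filter Topology intervalIntegral

/-! Both identities compare moments of bounded variables. The binomial coefficient `(m/α choose m)`
is the coefficient of `w ^ m` in `(1 + w) ^ (m/α)`, that is, a Cauchy integral of `(1 + w) ^ (m/α) /
w ^ m · dw/w`. By conjugation symmetry only the upper half of the contour and the imaginary part are
needed (`IsUpperArc.integral_cpow_div_pow_im`). The contour is chosen so that `(1 + w) ^ (1/α) / w`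
is real and positive on it. Parametrised by the argument `θ = πu` of `w`, that quantity is
`kanterVar α u ^ (1/α)`, while `Im (dw/w) = dθ`. Hence the Cauchy integral is the `m`-th moment of
`K_α ^ (1/α)` (`integral_kanterVar_rpow`), and Weierstrass approximation gives uniqueness of the
law. The symmetry between `α` and `1 - α` is visible in the formula for `b_α`.

For `α = p/n`, the moments of `K ^ n` are `(nm)! / ((pm)! ((n-p)m)!)`. Gauss's multiplication
formula splits each factorial into rising factorials at the points `i/n`, `j/p` and `k/(n-p)`. A
Beta moment is a quotient of two rising factorials, so the indices `q_j` only have to pair the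
points `i/n` with the others so that no second Beta parameter is negative. -/

theorem HasDerivAt.cpow_const_of_real {f : ℝ → ℂ} {f' c : ℂ} {x : ℝ} (hf : HasDerivAt f f' x)
    (h0 : f x ∈ Complex.slitPlane) :
    HasDerivAt (fun y => f y ^ c) (c * f x ^ (c - 1) * f') x := by
  have := ((hasDerivAt_id (f x)).cpow_const (c := c) h0).comp x hf
  simpa [Function.comp_def] using this

/-- A continuously differentiable arc `z` on `[0, π]`, with derivative `z'`, which joins a positive
real number to `-1` through the open upper half plane. -/
structure IsUpperArc (z z' : ℝ → ℂ) : Prop where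
  hasDerivAt : ∀ θ ∈ Icc 0 Real.pi, HasDerivAt z (z' θ) θ
  continuousOn_deriv : ContinuousOn z' (Icc 0 Real.pi)
  start_pos : ∃ r : ℝ, 0 < r ∧ z 0 = r
  end_eq : z Real.pi = -1
  im_pos : ∀ θ ∈ Ioo 0 Real.pi, 0 < (z θ).im

namespace IsUpperArc

variable {z z' : ℝ → ℂ}

theorem continuousOn (h : IsUpperArc z z') : ContinuousOn z (Icc 0 Real.pi) :=
  fun θ hθ => (h.hasDerivAt θ hθ).continuousAt.continuousWithinAt

theorem ne_zero (h : IsUpperArc z z') {θ : ℝ} (hθ : θ ∈ Icc 0 Real.pi) : z θ ≠ 0 := by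
  rcases eq_or_lt_of_le hθ.1 with h0 | h0
  · obtain ⟨r, hr, hz⟩ := h.start_pos
    rw [← h0, hz]
    exact_mod_cast hr.ne'
  rcases eq_or_lt_of_le hθ.2 with h1 | h1
  · rw [h1, h.end_eq]
    simp
  · intro h2
    have := h.im_pos θ ⟨h0, h1⟩
    simp [h2] at this

theorem continuousOn_logDeriv (h : IsUpperArc z z') :
    ContinuousOn (fun θ => z' θ / z θ) (Icc 0 Real.pi) :=
  h.continuousOn_deriv.div h.continuousOn fun _ hθ => h.ne_zero hθ

theorem one_add_mem_slitPlane (h : IsUpperArc z z') {θ : ℝ} (hθ : θ ∈ Ico 0 Real.pi) :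
    1 + z θ ∈ Complex.slitPlane := by
  rcases eq_or_lt_of_le hθ.1 with h0 | h0
  · obtain ⟨r, hr, hz⟩ := h.start_pos
    left
    rw [← h0, hz]
    simp
    linarith
  · right
    have := h.im_pos θ ⟨h0, hθ.2⟩
    simp
    exact this.ne'

theorem one_add_mul_mem_slitPlane (h : IsUpperArc z z') {t θ : ℝ} (ht : t ∈ Ico (0 : ℝ) 1)
    (hθ : θ ∈ Icc 0 Real.pi) : 1 + t * z θ ∈ Complex.slitPlane := by
  rcases eq_or_lt_of_le ht.1 with t0 | t0
  · rw [← t0]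
    simp
  rcases eq_or_lt_of_le hθ.1 with h0 | h0
  · obtain ⟨r, hr, hz⟩ := h.start_pos
    left
    rw [← h0, hz]
    simp
    positivity
  rcases eq_or_lt_of_le hθ.2 with h1 | h1
  · left
    rw [h1, h.end_eq]
    simp
    exact ht.2
  · right
    have := h.im_pos θ ⟨h0, h1⟩
    simp
    exact ⟨t0.ne', this.ne'⟩

theorem continuousOn_cpow (h : IsUpperArc z z') {c : ℝ} (hc : 0 < c) :
    ContinuousOn (fun p : ℝ × ℝ => (1 + (p.1 : ℂ) * z p.2) ^ (c : ℂ))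
      (Icc 0 1 ×ˢ Icc 0 Real.pi) := by
  have hlin : ContinuousOn (fun p : ℝ × ℝ => 1 + (p.1 : ℂ) * z p.2)
      (Icc 0 1 ×ˢ Icc 0 Real.pi) := by
    have : ContinuousOn (fun p : ℝ × ℝ => z p.2) (Icc 0 1 ×ˢ Icc 0 Real.pi) :=
      h.continuousOn.comp continuousOn_snd fun p hp => hp.2
    exact continuousOn_const.add ((by fun_prop : Continuous fun p : ℝ × ℝ => (p.1 : ℂ)).continuousOn.mul this)
  rintro ⟨t, θ⟩ ⟨ht, hθ⟩
  have hcpow : ContinuousAt (fun w : ℂ => w ^ (c : ℂ)) (1 + t * z θ) := by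
    rcases eq_or_lt_of_le ht.2 with t1 | t1
    · rcases eq_or_lt_of_le hθ.2 with h1 | h1
      -- The only corner where the base vanishes; `0 < c` keeps the power continuous there.
      · have : 1 + (t : ℂ) * z θ = 0 := by
          simp only at t1 h1
          rw [t1, h1, h.end_eq]
          simp
        rw [this]
        have := Complex.continuousAt_cpow_zero_of_re_pos (z := (c : ℂ)) (by simpa using hc)
        exact ContinuousAt.comp (f := fun w : ℂ => (w, (c : ℂ))) this (by fun_prop)
      · simp only at t1
        refine continuousAt_cpow_const ?_
        rw [t1]
        simpa using h.one_add_mem_slitPlane ⟨hθ.1, h1⟩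
    · exact continuousAt_cpow_const (h.one_add_mul_mem_slitPlane ⟨ht.1, t1⟩ hθ)
  exact ContinuousAt.comp_continuousWithinAt (f := fun p : ℝ × ℝ => 1 + (p.1 : ℂ) * z p.2)
    (x := (t, θ)) hcpow (hlin (t, θ) ⟨ht, hθ⟩)

theorem continuousOn_one_add_cpow (h : IsUpperArc z z') {c : ℝ} (hc : 0 < c) :
    ContinuousOn (fun θ => (1 + z θ) ^ (c : ℂ)) (Icc 0 Real.pi) := by
  have := (h.continuousOn_cpow hc).comp (f := fun θ : ℝ => ((1 : ℝ), θ)) (s := Icc 0 Real.pi)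
    (by fun_prop) (fun θ hθ => ⟨by simp, hθ⟩)
  simpa [Function.comp_def] using this

/-- The integrand has the primitive `(1 + t z) ^ c / t`, which is real at both ends of the arc. -/
theorem integral_cpow_mul_deriv_im (h : IsUpperArc z z') {c t : ℝ}
    (ht : t ∈ Ioo (0 : ℝ) 1) :
    (∫ θ in 0..Real.pi, (c : ℂ) * (1 + t * z θ) ^ ((c : ℂ) - 1) * z' θ).im = 0 := by
  have hder : ∀ θ ∈ uIcc 0 Real.pi, HasDerivAt (fun θ => (1 + t * z θ) ^ (c : ℂ) / t)
      ((c : ℂ) * (1 + t * z θ) ^ ((c : ℂ) - 1) * z' θ) θ := by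
    intro θ hθ
    rw [uIcc_of_le Real.pi_pos.le] at hθ
    have h1 : HasDerivAt (fun θ => 1 + (t : ℂ) * z θ) (t * z' θ) θ :=
      ((h.hasDerivAt θ hθ).const_mul (t : ℂ)).const_add 1
    have h2 := (h1.cpow_const_of_real (c := (c : ℂ))
      (h.one_add_mul_mem_slitPlane ⟨ht.1.le, ht.2⟩ hθ)).div_const (t : ℂ)
    convert! h2 using 1
    have : (t : ℂ) ≠ 0 := by exact_mod_cast ht.1.ne'
    field_simp
  rw [integral_eq_sub_of_hasDerivAt hder]
  · obtain ⟨r, hr, hz⟩ := h.start_pos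
    have e1 : (1 : ℂ) + t * -1 = ((1 - t : ℝ) : ℂ) := by push_cast; ring
    have e2 : (1 : ℂ) + t * r = ((1 + t * r : ℝ) : ℂ) := by push_cast; ring
    have : 0 ≤ 1 + t * r := by have := ht.1; positivity
    rw [h.end_eq, hz, e1, e2, ← Complex.ofReal_cpow (by linarith [ht.2]),
      ← Complex.ofReal_cpow this]
    norm_cast
  · refine ContinuousOn.intervalIntegrable ?_
    rw [uIcc_of_le Real.pi_pos.le]
    refine (continuousOn_const.mul ?_).mul h.continuousOn_deriv
    refine ContinuousOn.cpow_const ?_ fun θ hθ => h.one_add_mul_mem_slitPlane ⟨ht.1.le, ht.2⟩ hθ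
    exact continuousOn_const.add (continuousOn_const.mul h.continuousOn)

/-- The mean value property of `w ↦ (1 + w) ^ c` along a dilated arc. -/
theorem integral_cpow_sub_one_im (h : IsUpperArc z z') {c s : ℝ}
    (hs : s ∈ Ioo (0 : ℝ) 1) :
    (∫ θ in 0..Real.pi, ((1 + s * z θ) ^ (c : ℂ) - 1) * (z' θ / z θ)).im = 0 := by
  -- The exponent `c - 1` may be negative, so `t` stays at most `s < 1`, away from the zero of `1 +
  -- z` at `θ = π`.
  have hcont : ContinuousOn (fun p : ℝ × ℝ => (c : ℂ) * (1 + p.1 * z p.2) ^ ((c : ℂ) - 1) * z' p.2)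
      (Icc 0 s ×ˢ Icc 0 Real.pi) := by
    have hz : ContinuousOn (fun p : ℝ × ℝ => z p.2) (Icc 0 s ×ˢ Icc 0 Real.pi) :=
      h.continuousOn.comp continuousOn_snd fun p hp => hp.2
    have hz' : ContinuousOn (fun p : ℝ × ℝ => z' p.2) (Icc 0 s ×ˢ Icc 0 Real.pi) :=
      h.continuousOn_deriv.comp continuousOn_snd fun p hp => hp.2
    refine (continuousOn_const.mul ?_).mul hz'
    refine ContinuousOn.cpow_const (continuousOn_const.add
      ((by fun_prop : Continuous fun p : ℝ × ℝ => (p.1 : ℂ)).continuousOn.mul hz)) fun p hp => ?_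
    exact h.one_add_mul_mem_slitPlane ⟨hp.1.1, hp.1.2.trans_lt hs.2⟩ hp.2
  have hswap := intervalIntegral_intervalIntegral_swap
    (F := fun t θ : ℝ => (c : ℂ) * (1 + t * z θ) ^ ((c : ℂ) - 1) * z' θ)
    (a := 0) (b := s) (c := 0) (d := Real.pi) (by
      refine (hcont.integrableOn_compact (isCompact_Icc.prod isCompact_Icc)).mono_set ?_
      rw [uIoc_of_le hs.1.le, uIoc_of_le Real.pi_pos.le]
      exact prod_mono Ioc_subset_Icc_self Ioc_subset_Icc_self)
  have hinner : ∀ θ ∈ uIcc 0 Real.pi,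
      ∫ t in 0..s, (c : ℂ) * (1 + t * z θ) ^ ((c : ℂ) - 1) * z' θ =
        ((1 + s * z θ) ^ (c : ℂ) - 1) * (z' θ / z θ) := by
    intro θ hθ
    rw [uIcc_of_le Real.pi_pos.le] at hθ
    have hder : ∀ t ∈ uIcc 0 s, HasDerivAt (fun t : ℝ => (1 + t * z θ) ^ (c : ℂ) * (z' θ / z θ))
        ((c : ℂ) * (1 + t * z θ) ^ ((c : ℂ) - 1) * z' θ) t := by
      intro t ht
      rw [uIcc_of_le hs.1.le] at ht
      have h1 : HasDerivAt (fun t : ℝ => 1 + (t : ℂ) * z θ) (1 * z θ) t :=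
        ((Complex.ofRealCLM.hasDerivAt (x := t)).mul_const (z θ)).const_add 1
      have h2 := (h1.cpow_const_of_real (c := (c : ℂ))
        (h.one_add_mul_mem_slitPlane ⟨ht.1, ht.2.trans_lt hs.2⟩ hθ)).mul_const (z' θ / z θ)
      convert! h2 using 1
      have := h.ne_zero hθ
      field_simp
    rw [integral_eq_sub_of_hasDerivAt hder]
    · simp [sub_mul]
    · refine ContinuousOn.intervalIntegrable ?_
      rw [uIcc_of_le hs.1.le]
      exact hcont.comp (f := fun t : ℝ => (t, θ)) (by fun_prop) fun t ht => ⟨ht, hθ⟩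
  -- With the order of integration exchanged, the integral over `θ` has zero imaginary part for
  -- every `t > 0`.
  rw [← integral_congr hinner, ← hswap]
  have hI : IntervalIntegrable
      (fun t : ℝ => ∫ θ in 0..Real.pi, (c : ℂ) * (1 + t * z θ) ^ ((c : ℂ) - 1) * z' θ)
      volume 0 s := by
    have hint := (hcont.integrableOn_compact (μ := volume)
      (isCompact_Icc.prod isCompact_Icc)).mono_set
      (prod_mono (Ioc_subset_Icc_self (a := 0) (b := s)) (Ioc_subset_Icc_self (b := Real.pi)))
    rw [IntegrableOn, Measure.volume_eq_prod, ← Measure.prod_restrict] at hint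
    rw [intervalIntegrable_iff, uIoc_of_le hs.1.le]
    simp_rw [intervalIntegral.integral_of_le Real.pi_pos.le]
    exact hint.integral_prod_left
  have him := Complex.imCLM.intervalIntegral_comp_comm hI
  simp only [Complex.imCLM_apply] at him
  rw [← him]
  refine (intervalIntegral.integral_congr_ae ?_).trans (integral_zero (a := 0) (b := s))
  filter_upwards with t ht
  rw [uIoc_of_le hs.1.le] at ht
  exact h.integral_cpow_mul_deriv_im ⟨ht.1, ht.2.trans_lt hs.2⟩

/-- The dilation `s` tends to `1` in `integral_cpow_sub_one_im`; the integrands stay bounded because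
`0 < c`. -/
theorem integral_cpow_im (h : IsUpperArc z z') {c : ℝ} (hc : 0 < c) :
    (∫ θ in 0..Real.pi, (1 + z θ) ^ (c : ℂ) * (z' θ / z θ)).im =
      (∫ θ in 0..Real.pi, z' θ / z θ).im := by
  have hw := h.continuousOn_logDeriv
  have hcont : ContinuousOn (fun p : ℝ × ℝ =>
      ((1 + p.1 * z p.2) ^ (c : ℂ) - 1) * (z' p.2 / z p.2)) (Icc 0 1 ×ˢ Icc 0 Real.pi) :=
    ((h.continuousOn_cpow hc).sub continuousOn_const).mul
      (hw.comp continuousOn_snd fun p hp => hp.2)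
  obtain ⟨C, hC⟩ := (isCompact_Icc.prod isCompact_Icc).exists_bound_of_continuousOn hcont
  have hlim : Tendsto
      (fun s : ℝ => ∫ θ in 0..Real.pi, ((1 + s * z θ) ^ (c : ℂ) - 1) * (z' θ / z θ))
      (𝓝[<] 1) (𝓝 (∫ θ in 0..Real.pi, ((1 + (1 : ℝ) * z θ) ^ (c : ℂ) - 1) * (z' θ / z θ))) := by
    have hev : ∀ᶠ s : ℝ in 𝓝[<] 1, s ∈ Ioo (0 : ℝ) 1 :=
      Ioo_mem_nhdsLT one_pos
    refine tendsto_integral_filter_of_dominated_convergence (fun _ => C) ?_ ?_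
      intervalIntegrable_const ?_
    · filter_upwards [hev] with s hs
      rw [uIoc_of_le Real.pi_pos.le]
      refine (ContinuousOn.mono ?_ Ioc_subset_Icc_self).aestronglyMeasurable measurableSet_Ioc
      exact hcont.comp (f := fun θ : ℝ => (s, θ)) (by fun_prop)
        fun θ hθ => ⟨⟨hs.1.le, hs.2.le⟩, hθ⟩
    · filter_upwards [hev] with s hs
      filter_upwards with θ hθ
      rw [uIoc_of_le Real.pi_pos.le] at hθ
      exact hC (s, θ) ⟨⟨hs.1.le, hs.2.le⟩, Ioc_subset_Icc_self hθ⟩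
    · filter_upwards with θ hθ
      rw [uIoc_of_le Real.pi_pos.le] at hθ
      have := hcont.comp (f := fun s : ℝ => (s, θ)) (s := Icc 0 1) (by fun_prop)
        fun s hs => ⟨hs, Ioc_subset_Icc_self hθ⟩
      exact (this 1 (by simp)).tendsto.mono_left
        (nhdsWithin_le_of_mem (Icc_mem_nhdsLT one_pos))
  have hlim' := (Complex.continuous_im.tendsto _).comp hlim
  have hzero := tendsto_nhds_unique hlim' (tendsto_const_nhds.congr' (by
    filter_upwards [Ioo_mem_nhdsLT (zero_lt_one (α := ℝ))] with s hs
    exact (h.integral_cpow_sub_one_im hs).symm))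
  have hi : IntervalIntegrable (fun θ => z' θ / z θ) volume 0 Real.pi :=
    ContinuousOn.intervalIntegrable (by rwa [uIcc_of_le Real.pi_pos.le])
  have hi' : IntervalIntegrable (fun θ => (1 + z θ) ^ (c : ℂ) * (z' θ / z θ)) volume 0 Real.pi :=
    ContinuousOn.intervalIntegrable (by
      rw [uIcc_of_le Real.pi_pos.le]
      exact (h.continuousOn_one_add_cpow hc).mul hw)
  simp only [Complex.ofReal_one, one_mul, sub_mul] at hzero
  rw [integral_sub hi' hi, Complex.sub_im] at hzero
  linarith

theorem continuousOn_cpow_div (h : IsUpperArc z z') {a : ℝ} (ha : 0 < a) (k : ℕ) :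
    ContinuousOn (fun θ => (1 + z θ) ^ (a : ℂ) / z θ ^ k * (z' θ / z θ)) (Icc 0 Real.pi) :=
  ((h.continuousOn_one_add_cpow ha).div (h.continuousOn.pow k) fun _ hθ =>
    pow_ne_zero k (h.ne_zero hθ)).mul h.continuousOn_logDeriv

/-- Integration by parts with `(1 + z) ^ a / z ^ (k + 1)`, whose boundary values are real: it
vanishes at `-1` and is real at the positive starting point. -/
theorem integral_cpow_div_succ_im (h : IsUpperArc z z') {a : ℝ} (ha : 1 < a) (k : ℕ) :
    (k + 1) * (∫ θ in 0..Real.pi, (1 + z θ) ^ (a : ℂ) / z θ ^ (k + 1) * (z' θ / z θ)).im =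
      a * (∫ θ in 0..Real.pi, (1 + z θ) ^ ((a - 1 : ℝ) : ℂ) / z θ ^ k * (z' θ / z θ)).im := by
  have ha0 : 0 < a := by linarith
  have hi : ∀ {b : ℝ} (_ : 0 < b) (j : ℕ), IntervalIntegrable
      (fun θ => (1 + z θ) ^ (b : ℂ) / z θ ^ j * (z' θ / z θ)) volume 0 Real.pi := fun hb j =>
    ContinuousOn.intervalIntegrable (by
      rw [uIcc_of_le Real.pi_pos.le]
      exact h.continuousOn_cpow_div hb j)
  have i1 := (hi (b := a - 1) (by linarith) k).const_mul (a : ℂ)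
  have i2 := (hi ha0 (k + 1)).const_mul ((k : ℂ) + 1)
  have hftc := integral_eq_sub_of_hasDerivAt_of_le Real.pi_pos.le
    (f := fun θ => (1 + z θ) ^ (a : ℂ) / z θ ^ (k + 1))
    (f' := fun θ => (a : ℂ) * ((1 + z θ) ^ ((a - 1 : ℝ) : ℂ) / z θ ^ k * (z' θ / z θ)) -
      ((k : ℂ) + 1) * ((1 + z θ) ^ (a : ℂ) / z θ ^ (k + 1) * (z' θ / z θ)))
    ((h.continuousOn_one_add_cpow ha0).div (h.continuousOn.pow _) fun _ hθ =>
      pow_ne_zero _ (h.ne_zero hθ)) (by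
      intro θ hθ
      have hθ' : θ ∈ Icc 0 Real.pi := Ioo_subset_Icc_self hθ
      have hz := h.ne_zero hθ'
      have h1 := ((h.hasDerivAt θ hθ').const_add 1).cpow_const_of_real (c := (a : ℂ))
        (h.one_add_mem_slitPlane ⟨hθ.1.le, hθ.2⟩)
      have h2 := (h.hasDerivAt θ hθ').pow (k + 1)
      convert! h1.div h2 (pow_ne_zero _ hz) using 1
      push_cast
      simp only [Pi.pow_apply]
      field_simp
      ring) (i1.sub i2)
  rw [integral_sub i1 i2, intervalIntegral.integral_const_mul,
    intervalIntegral.integral_const_mul] at hftc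
  obtain ⟨r, hr, hz⟩ := h.start_pos
  have e2 : (1 : ℂ) + r = ((1 + r : ℝ) : ℂ) := by push_cast; ring
  rw [h.end_eq, hz, add_neg_cancel, Complex.zero_cpow (by exact_mod_cast ha0.ne'), e2,
    ← Complex.ofReal_cpow (by positivity), zero_div, zero_sub, ← Complex.ofReal_pow,
    ← Complex.ofReal_div, ← Complex.ofReal_neg] at hftc
  have := congrArg Complex.im hftc
  rw [Complex.sub_im, Complex.ofReal_im, Complex.im_ofReal_mul] at this
  have e3 : ((k : ℂ) + 1) = ((k + 1 : ℝ) : ℂ) := by push_cast; ring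
  rw [e3, Complex.im_ofReal_mul] at this
  linarith

/-- The coefficient of `w ^ m` in `(1 + w) ^ a`, as an integral over the arc. -/
theorem integral_cpow_div_pow_im (h : IsUpperArc z z') (m : ℕ) {a : ℝ} (ha : m < a) :
    (∫ θ in 0..Real.pi, (1 + z θ) ^ (a : ℂ) / z θ ^ m * (z' θ / z θ)).im =
      Real.Gamma (1 + a) / (Real.Gamma (1 + a - m) * m.factorial) *
        (∫ θ in 0..Real.pi, z' θ / z θ).im := by
  induction m generalizing a with
  | zero =>
    have ha0 : 0 < a := by simpa using ha
    have : Real.Gamma (1 + a) ≠ 0 := (Real.Gamma_pos_of_pos (by linarith)).ne'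
    simp [h.integral_cpow_im ha0, this]
  | succ k ih =>
    push_cast at ha
    have hk : (0 : ℝ) ≤ k := k.cast_nonneg
    have h1 := h.integral_cpow_div_succ_im (a := a) (by linarith) k
    rw [ih (a := a - 1) (by linarith)] at h1
    have e1 : Real.Gamma (1 + a) = a * Real.Gamma a := by
      rw [add_comm, Real.Gamma_add_one (by linarith)]
    have e2 : 1 + (a - 1) = a := by ring
    have e3 : 1 + a - ((k + 1 : ℕ) : ℝ) = a - k := by push_cast; ring
    have hG : Real.Gamma (a - k) ≠ 0 := (Real.Gamma_pos_of_pos (by linarith)).ne'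
    rw [e2] at h1
    rw [e3, e1, Nat.factorial_succ]
    have hk1 : (k : ℝ) + 1 ≠ 0 := by positivity
    have hf : (k.factorial : ℝ) ≠ 0 := by positivity
    push_cast
    field_simp at h1 ⊢
    linarith

end IsUpperArc

/-! ### The Kanter arc and the moments of the Kanter variable. -/

theorem Real.contDiff_sinc {n : WithTop ℕ∞} : ContDiff ℝ n Real.sinc := by
  have hd : Differentiable ℂ (dslope Complex.sin 0) := by
    rw [← differentiableOn_univ, Complex.differentiableOn_dslope univ_mem]
    exact Complex.differentiable_sin.differentiableOn
  have h := hd.contDiff (n := n)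
  -- Smoothness at `0` comes from the removable singularity of `sin z / z`.
  have h2 : Real.sinc = fun x : ℝ => (dslope Complex.sin 0 (x : ℂ)).re := by
    funext x
    rcases eq_or_ne x 0 with rfl | hx
    · simp
    · have hx' : (x : ℂ) ≠ 0 := by exact_mod_cast hx
      rw [Real.sinc_of_ne_zero hx, dslope_of_ne _ hx', slope_def_field, Complex.sin_zero, sub_zero,
        sub_zero]
      norm_cast
  rw [h2]
  exact h.real_of_complex

theorem Real.sinc_pos_of_nonneg_of_lt_pi {x : ℝ} (h0 : 0 ≤ x) (h1 : x < Real.pi) :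
    0 < Real.sinc x := by
  rcases eq_or_lt_of_le h0 with rfl | h
  · simp
  · rw [Real.sinc_of_ne_zero h.ne']
    exact div_pos (Real.sin_pos_of_pos_of_lt_pi h h1) h

noncomputable section

/-- The modulus `sin (αθ) / sin ((1 - α)θ)` of the point of argument `θ` at which
`(1 + w) ^ (1 / α) / w` is real and positive. -/
def kanterRadius (α θ : ℝ) : ℝ := α / (1 - α) * (Real.sinc (α * θ) / Real.sinc ((1 - α) * θ))

/-- The arc on which `(1 + w) ^ (1 / α) / w` is real and positive. -/
def kanterArc (α θ : ℝ) : ℂ := kanterRadius α θ * Complex.exp (θ * Complex.I)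

/-- The derivative of `kanterArc`. -/
def kanterArcDeriv (α θ : ℝ) : ℂ :=
  (deriv (kanterRadius α) θ + kanterRadius α θ * Complex.I) * Complex.exp (θ * Complex.I)

end

section

variable {α θ : ℝ}

theorem mul_mem_Ico_pi (h0 : 0 < α) (h1 : α < 1) (hθ : θ ∈ Icc 0 Real.pi) :
    0 ≤ α * θ ∧ α * θ < Real.pi := by
  refine ⟨mul_nonneg h0.le hθ.1, ?_⟩
  have := mul_le_mul_of_nonneg_left hθ.2 h0.le
  nlinarith [Real.pi_pos]

theorem sin_mul_pos (h0 : 0 < α) (h1 : α < 1) (hθ : 0 < θ) (hθ' : θ ≤ Real.pi) :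
    0 < Real.sin (α * θ) :=
  Real.sin_pos_of_pos_of_lt_pi (mul_pos h0 hθ) (mul_mem_Ico_pi h0 h1 ⟨hθ.le, hθ'⟩).2

theorem kanterRadius_pos (h0 : 0 < α) (h1 : α < 1) (hθ : θ ∈ Icc 0 Real.pi) :
    0 < kanterRadius α θ := by
  have hA := mul_mem_Ico_pi h0 h1 hθ
  have hB := mul_mem_Ico_pi (α := 1 - α) (by linarith) (by linarith) hθ
  have := Real.sinc_pos_of_nonneg_of_lt_pi hA.1 hA.2
  have := Real.sinc_pos_of_nonneg_of_lt_pi hB.1 hB.2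
  have : 0 < 1 - α := by linarith
  unfold kanterRadius
  positivity

theorem kanterRadius_eq (h0 : 0 < α) (h1 : α < 1) (hθ : 0 < θ) :
    kanterRadius α θ = Real.sin (α * θ) / Real.sin ((1 - α) * θ) := by
  have : 0 < 1 - α := by linarith
  rw [kanterRadius, Real.sinc_of_ne_zero (by positivity), Real.sinc_of_ne_zero (by positivity)]
  rcases eq_or_ne (Real.sin ((1 - α) * θ)) 0 with h | h
  · simp [h]
  · field_simp

/-- The form with `sinc` covers `θ = 0`, where the quotient of sines is `0 / 0`. -/
theorem contDiffAt_kanterRadius (h0 : 0 < α) (h1 : α < 1) (hθ : θ ∈ Icc 0 Real.pi) :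
    ContDiffAt ℝ 1 (kanterRadius α) θ := by
  have hB := mul_mem_Ico_pi (α := 1 - α) (by linarith) (by linarith) hθ
  have hne := (Real.sinc_pos_of_nonneg_of_lt_pi hB.1 hB.2).ne'
  refine contDiffAt_const.mul (ContDiffAt.div ?_ ?_ hne)
  · exact (Real.contDiff_sinc.comp (contDiff_const.mul contDiff_id)).contDiffAt
  · exact (Real.contDiff_sinc.comp (contDiff_const.mul contDiff_id)).contDiffAt

/-- Law of sines in the triangle `-1, 0, w`, whose angles are `αθ`, `π - θ` and `(1 - α)θ`. -/
theorem one_add_kanterArc (h0 : 0 < α) (h1 : α < 1) (hθ : 0 < θ) (hθ' : θ ≤ Real.pi) :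
    1 + kanterArc α θ = ((Real.sin θ / Real.sin ((1 - α) * θ) : ℝ) : ℂ) *
      Complex.exp ((α * θ : ℝ) * Complex.I) := by
  have hS := (sin_mul_pos (α := 1 - α) (by linarith) (by linarith) hθ hθ').ne'
  have hs : Real.sin ((1 - α) * θ) =
      Real.sin θ * Real.cos (α * θ) - Real.cos θ * Real.sin (α * θ) := by
    rw [← Real.sin_sub]
    ring_nf
  rw [kanterArc, kanterRadius_eq h0 h1 hθ, Complex.exp_mul_I, Complex.exp_mul_I,
    ← Complex.ofReal_cos, ← Complex.ofReal_sin, ← Complex.ofReal_cos, ← Complex.ofReal_sin]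
  generalize Real.sin ((1 - α) * θ) = S at hS hs ⊢
  apply Complex.ext
  · simp only [Complex.add_re, Complex.one_re, Complex.mul_re, Complex.ofReal_re,
      Complex.ofReal_im, Complex.I_re, Complex.I_im, Complex.add_im, Complex.mul_im]
    field_simp
    linarith
  · simp only [Complex.add_re, Complex.one_im, Complex.mul_re, Complex.ofReal_re,
      Complex.ofReal_im, Complex.I_re, Complex.I_im, Complex.add_im, Complex.mul_im]
    field_simp
    ring

theorem isUpperArc_kanterArc (h0 : 0 < α) (h1 : α < 1) :
    IsUpperArc (kanterArc α) (kanterArcDeriv α) where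
  hasDerivAt θ hθ := by
    have hr : HasDerivAt (fun θ => (kanterRadius α θ : ℂ)) (deriv (kanterRadius α) θ : ℝ) θ :=
      ((contDiffAt_kanterRadius h0 h1 hθ).differentiableAt (by simp)).hasDerivAt.ofReal_comp
    have he : HasDerivAt (fun θ : ℝ => Complex.exp (θ * Complex.I))
        (Complex.exp (θ * Complex.I) * (1 * Complex.I)) θ :=
      ((Complex.ofRealCLM.hasDerivAt (x := θ)).mul_const Complex.I).cexp
    convert! hr.mul he using 1
    rw [kanterArcDeriv]
    ring
  continuousOn_deriv := by
    have hd : ContinuousOn (deriv (kanterRadius α)) (Icc 0 Real.pi) := fun θ hθ => by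
      have := (contDiffAt_kanterRadius h0 h1 hθ).continuousAt_fderiv (by simp)
      exact ((ContinuousLinearMap.apply ℝ ℝ (1 : ℝ)).continuous.continuousAt.comp
        this).continuousWithinAt
    have hr : ContinuousOn (kanterRadius α) (Icc 0 Real.pi) := fun θ hθ =>
      (contDiffAt_kanterRadius h0 h1 hθ).continuousAt.continuousWithinAt
    have hd' := Complex.continuous_ofReal.comp_continuousOn hd
    have hr' := Complex.continuous_ofReal.comp_continuousOn hr
    exact (hd'.add (hr'.mul continuousOn_const)).mul (by
      have : Continuous fun θ : ℝ => Complex.exp (θ * Complex.I) := by fun_prop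
      exact this.continuousOn)
  start_pos := ⟨kanterRadius α 0, kanterRadius_pos h0 h1 ⟨le_rfl, Real.pi_pos.le⟩,
    by simp [kanterArc]⟩
  end_eq := by
    have hS := (sin_mul_pos (α := α) h0 h1 Real.pi_pos le_rfl).ne'
    have : Real.sin ((1 - α) * Real.pi) = Real.sin (α * Real.pi) := by
      rw [← Real.sin_pi_sub]
      ring_nf
    rw [kanterArc, kanterRadius_eq h0 h1 Real.pi_pos, this, div_self hS]
    simp
  im_pos θ hθ := by
    have := kanterRadius_pos h0 h1 (Ioo_subset_Icc_self hθ)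
    have hs := Real.sin_pos_of_pos_of_lt_pi hθ.1 hθ.2
    rw [kanterArc, Complex.im_ofReal_mul, Complex.exp_ofReal_mul_I_im]
    positivity

/-- The arc is parametrised by its argument, so `Im (dw/w) = dθ`. -/
theorem kanterArc_logDeriv_im (h0 : 0 < α) (h1 : α < 1) (hθ : θ ∈ Icc 0 Real.pi) :
    (kanterArcDeriv α θ / kanterArc α θ).im = 1 := by
  have hr := (kanterRadius_pos h0 h1 hθ).ne'
  have hr' : (kanterRadius α θ : ℂ) ≠ 0 := by exact_mod_cast hr
  have : kanterArcDeriv α θ / kanterArc α θ =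
      ((deriv (kanterRadius α) θ / kanterRadius α θ : ℝ) : ℂ) + Complex.I := by
    rw [kanterArcDeriv, kanterArc]
    have := Complex.exp_ne_zero (θ * Complex.I)
    push_cast
    field_simp
  rw [this]
  simp

theorem kanterVar_nonneg (h0 : 0 < α) (h1 : α < 1) {u : ℝ} (hu : u ∈ Ioo (0 : ℝ) 1) :
    0 ≤ kanterVar α u := by
  have hθ : 0 < Real.pi * u := mul_pos Real.pi_pos hu.1
  have hθ' : Real.pi * u < Real.pi := by nlinarith [Real.pi_pos, hu.2]
  have hA := sin_mul_pos h0 h1 hθ hθ'.le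
  have hB := sin_mul_pos (α := 1 - α) (by linarith) (by linarith) hθ hθ'.le
  have hC := Real.sin_pos_of_pos_of_lt_pi hθ hθ'
  rw [kanterVar, show Real.pi * α * u = α * (Real.pi * u) by ring,
    show Real.pi * (1 - α) * u = (1 - α) * (Real.pi * u) by ring]
  positivity

/-- The phases cancel: `1 + w` has argument `αθ`, so its power `m/α` has the phase `mθ` of `w ^ m`.
The principal branch applies since `0 ≤ αθ < π`. -/
theorem cpow_div_pow_kanterArc (h0 : 0 < α) (h1 : α < 1) {u : ℝ} (hu : u ∈ Ioo (0 : ℝ) 1) (m : ℕ) :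
    (1 + kanterArc α (Real.pi * u)) ^ ((m / α : ℝ) : ℂ) / kanterArc α (Real.pi * u) ^ m =
      ((kanterVar α u ^ (m / α) : ℝ) : ℂ) := by
  have hθ : 0 < Real.pi * u := mul_pos Real.pi_pos hu.1
  have hθ' : Real.pi * u < Real.pi := by nlinarith [Real.pi_pos, hu.2]
  have hA := sin_mul_pos h0 h1 hθ hθ'.le
  have hB := sin_mul_pos (α := 1 - α) (by linarith) (by linarith) hθ hθ'.le
  have hC := Real.sin_pos_of_pos_of_lt_pi hθ hθ'
  have hαθ := mul_mem_Ico_pi h0 h1 ⟨hθ.le, hθ'.le⟩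
  rw [kanterVar, show Real.pi * α * u = α * (Real.pi * u) by ring,
    show Real.pi * (1 - α) * u = (1 - α) * (Real.pi * u) by ring]
  rw [one_add_kanterArc h0 h1 hθ hθ'.le, kanterArc, kanterRadius_eq h0 h1 hθ]
  generalize Real.pi * u = θ at *
  have hρ := div_pos hC hB
  have hpow : (((Real.sin θ / Real.sin ((1 - α) * θ) : ℝ) : ℂ) *
      Complex.exp ((α * θ : ℝ) * Complex.I)) ^ ((m / α : ℝ) : ℂ) =
      (((Real.sin θ / Real.sin ((1 - α) * θ)) ^ (m / α) : ℝ) : ℂ) *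
        Complex.exp (θ * Complex.I) ^ m := by
    rw [Complex.cpow_def_of_ne_zero (mul_ne_zero (by exact_mod_cast hρ.ne')
      (Complex.exp_ne_zero _)), Complex.log_ofReal_mul hρ (Complex.exp_ne_zero _),
      Complex.log_exp (by simp; linarith [Real.pi_pos]) (by simpa using hαθ.2.le), add_mul,
      Complex.exp_add, Real.rpow_def_of_pos hρ, ← Complex.exp_nat_mul]
    push_cast
    congr 2
    have : (α : ℂ) ≠ 0 := by exact_mod_cast h0.ne'
    field_simp
  rw [hpow, mul_pow, mul_div_mul_right _ _ (pow_ne_zero _ (Complex.exp_ne_zero _))]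
  norm_cast
  rw [Real.div_rpow hC.le hB.le, Real.div_rpow hC.le (by positivity), Real.mul_rpow (by positivity) (by positivity),
    ← Real.rpow_mul hA.le, ← Real.rpow_mul hB.le,
    mul_div_cancel₀ _ h0.ne', Real.rpow_natCast, div_pow,
    show (1 - α) * (m / α) = m / α - m by field_simp, Real.rpow_sub hB, Real.rpow_natCast]
  field_simp

instance : IsProbabilityMeasure unifLaw := ⟨by simp [unifLaw]⟩

theorem ae_unifLaw_mem : ∀ᵐ u ∂unifLaw, u ∈ Ioo (0 : ℝ) 1 :=
  ae_restrict_mem measurableSet_Ioo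

theorem measurable_kanterVar (α : ℝ) : Measurable (kanterVar α) := by
  unfold kanterVar
  fun_prop

theorem integral_kanterVar_rpow (h0 : 0 < α) (h1 : α < 1) (m : ℕ) :
    ∫ u, kanterVar α u ^ (m / α) ∂unifLaw = binomialMoment (1 / α) m := by
  -- The coefficient formula needs `m < m / α`, which fails at `m = 0`.
  rcases Nat.eq_zero_or_pos m with rfl | hm
  · simp [binomialMoment]
  have hm' : (0 : ℝ) < m := by exact_mod_cast hm
  have hma : (m : ℝ) < m / α := by
    rw [lt_div_iff₀ h0]
    nlinarith
  have h := isUpperArc_kanterArc h0 h1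
  have him : ∀ {f : ℝ → ℂ}, ContinuousOn f (Icc 0 Real.pi) →
      (∫ θ in 0..Real.pi, f θ).im = ∫ θ in 0..Real.pi, (f θ).im := fun {f} hf => by
    have hi : IntervalIntegrable f volume 0 Real.pi :=
      ContinuousOn.intervalIntegrable (by rwa [uIcc_of_le Real.pi_pos.le])
    simpa using (Complex.imCLM.intervalIntegral_comp_comm hi).symm
  have hmain := h.integral_cpow_div_pow_im m hma
  have hpi : ∫ θ in 0..Real.pi, (kanterArcDeriv α θ / kanterArc α θ).im = Real.pi := by
    rw [integral_congr (g := fun _ => (1 : ℝ))]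
    · simp
    · intro θ hθ
      rw [uIcc_of_le Real.pi_pos.le] at hθ
      exact kanterArc_logDeriv_im h0 h1 hθ
  rw [him h.continuousOn_logDeriv, hpi, him (h.continuousOn_cpow_div (hm'.trans hma) m)] at hmain
  have hsub := intervalIntegral.integral_comp_mul_left (a := 0) (b := 1) (fun θ =>
    ((1 + kanterArc α θ) ^ ((m / α : ℝ) : ℂ) / kanterArc α θ ^ m *
      (kanterArcDeriv α θ / kanterArc α θ)).im) Real.pi_ne_zero
  rw [mul_zero, mul_one, hmain] at hsub
  rw [unifLaw, ← integral_Ioc_eq_integral_Ioo, ← intervalIntegral.integral_of_le zero_le_one]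
  rw [integral_of_le zero_le_one, integral_Ioc_eq_integral_Ioo] at hsub ⊢
  rw [setIntegral_congr_fun (g := fun u => kanterVar α u ^ (m / α)) measurableSet_Ioo] at hsub
  · rw [hsub, binomialMoment, show (m : ℝ) * (1 / α) = m / α by ring,
      show 1 + (m : ℝ) * (1 / α - 1) = 1 + m / α - m by ring, smul_eq_mul]
    have := Real.pi_ne_zero
    field_simp
  · intro u hu
    have hθ' : Real.pi * u ∈ Icc 0 Real.pi :=
      ⟨mul_nonneg Real.pi_pos.le hu.1.le, by nlinarith [Real.pi_pos, hu.2]⟩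
    simp only
    rw [cpow_div_pow_kanterArc h0 h1 hu, Complex.im_ofReal_mul,
      kanterArc_logDeriv_im h0 h1 hθ', mul_one]

/-- The variable is a continuous function on the compact arc, by `cpow_div_pow_kanterArc` with `m =
1`. -/
theorem exists_kanterVar_rpow_le (h0 : 0 < α) (h1 : α < 1) :
    ∃ C : ℝ, ∀ u ∈ Ioo (0 : ℝ) 1, kanterVar α u ^ (1 / α) ≤ C := by
  have h := isUpperArc_kanterArc h0 h1
  have hcont : ContinuousOn (fun θ => (1 + kanterArc α θ) ^ (((1 : ℕ) / α : ℝ) : ℂ) /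
      kanterArc α θ ^ 1) (Icc 0 Real.pi) :=
    (h.continuousOn_one_add_cpow (by positivity)).div (h.continuousOn.pow 1) fun θ hθ =>
      pow_ne_zero _ (h.ne_zero hθ)
  obtain ⟨C, hC⟩ := isCompact_Icc.exists_bound_of_continuousOn hcont
  refine ⟨C, fun u hu => ?_⟩
  have := hC (Real.pi * u)
    ⟨mul_nonneg Real.pi_pos.le hu.1.le, by nlinarith [Real.pi_pos, hu.2]⟩
  rw [cpow_div_pow_kanterArc h0 h1 hu, Complex.norm_real] at this
  simpa using (le_abs_self _).trans this

end

/-! ### Bounded laws are determined by their moments. -/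

theorem integrable_eval_of_ae_bounded {μ : Measure ℝ} [IsFiniteMeasure μ] {C : ℝ}
    (hC : ∀ᵐ x ∂μ, |x| ≤ C) {f : ℝ → ℝ} (hf : Continuous f) : Integrable f μ := by
  obtain ⟨B, hB⟩ := (isCompact_Icc (a := -C) (b := C)).exists_bound_of_continuousOn hf.continuousOn
  refine Integrable.of_bound hf.aestronglyMeasurable B ?_
  filter_upwards [hC] with x hx
  exact hB x (abs_le.1 hx)

/-- A probability measure on `ℝ` with bounded support is determined by its moments. -/
theorem MeasureTheory.Measure.ext_of_moments {μ ν : Measure ℝ} [IsProbabilityMeasure μ]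
    [IsProbabilityMeasure ν] {C D : ℝ} (hC : ∀ᵐ x ∂μ, |x| ≤ C) (hD : ∀ᵐ x ∂ν, |x| ≤ D)
    (h : ∀ n : ℕ, ∫ x, x ^ n ∂μ = ∫ x, x ^ n ∂ν) : μ = ν := by
  set M := max C D
  have hμ : ∀ᵐ x ∂μ, |x| ≤ M := hC.mono fun x hx => hx.trans (le_max_left _ _)
  have hν : ∀ᵐ x ∂ν, |x| ≤ M := hD.mono fun x hx => hx.trans (le_max_right _ _)
  refine ext_of_forall_integral_eq_of_IsFiniteMeasure fun f => ?_
  have hpoly : ∀ p : Polynomial ℝ, ∫ x, p.eval x ∂μ = ∫ x, p.eval x ∂ν := by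
    intro p
    simp_rw [Polynomial.eval_eq_sum_range]
    rw [integral_finsetSum, integral_finsetSum]
    · simp_rw [integral_const_mul, h]
    · exact fun i _ => integrable_eval_of_ae_bounded hν (by fun_prop)
    · exact fun i _ => integrable_eval_of_ae_bounded hμ (by fun_prop)
  have happrox : ∀ (ρ : Measure ℝ) [IsProbabilityMeasure ρ], (∀ᵐ x ∂ρ, |x| ≤ M) →
      ∀ (p : Polynomial ℝ) (ε : ℝ), (∀ x ∈ Icc (-M) M, |p.eval x - f x| < ε) →
        |∫ x, p.eval x ∂ρ - ∫ x, f x ∂ρ| ≤ ε := by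
    intro ρ _ hρ p ε hp
    rw [← integral_sub (integrable_eval_of_ae_bounded hρ p.continuous)
      (integrable_eval_of_ae_bounded hρ f.continuous), ← Real.norm_eq_abs]
    refine (norm_integral_le_of_norm_le_const (C := ε) ?_).trans (by simp)
    filter_upwards [hρ] with x hx
    exact (hp x (abs_le.1 hx)).le
  refine eq_of_abs_sub_le_all fun ε hε => ?_
  obtain ⟨p, hp⟩ := exists_polynomial_near_of_continuousOn (-M) M f f.continuous.continuousOn
    (ε / 2) (by positivity)
  have h1 := happrox μ hμ p _ hp
  have h2 := happrox ν hν p _ hp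
  rw [hpoly p] at h1
  rw [abs_le] at h1 h2 ⊢
  constructor <;> linarith [h1.1, h1.2, h2.1, h2.2]

/-- Bounded random variables with the same moments have the same law. -/
theorem identDistrib_of_moments {Ω Ω' : Type*} [MeasurableSpace Ω] [MeasurableSpace Ω']
    {μ : Measure Ω} {ν : Measure Ω'} [IsProbabilityMeasure μ] [IsProbabilityMeasure ν]
    {X : Ω → ℝ} {Y : Ω' → ℝ} (hX : Measurable X) (hY : Measurable Y) {C D : ℝ}
    (hC : ∀ᵐ ω ∂μ, |X ω| ≤ C) (hD : ∀ᵐ ω ∂ν, |Y ω| ≤ D)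
    (h : ∀ n : ℕ, ∫ ω, X ω ^ n ∂μ = ∫ ω, Y ω ^ n ∂ν) : IdentDistrib X Y μ ν := by
  refine ⟨hX.aemeasurable, hY.aemeasurable, ?_⟩
  have := Measure.isProbabilityMeasure_map (μ := μ) hX.aemeasurable
  have := Measure.isProbabilityMeasure_map (μ := ν) hY.aemeasurable
  refine Measure.ext_of_moments (C := C) (D := D) ?_ ?_ fun n => ?_
  · rw [ae_map_iff hX.aemeasurable (measurableSet_le (by fun_prop) (by fun_prop))]
    exact hC
  · rw [ae_map_iff hY.aemeasurable (measurableSet_le (by fun_prop) (by fun_prop))]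
    exact hD
  · rw [integral_map hX.aemeasurable (by fun_prop), integral_map hY.aemeasurable (by fun_prop), h]

/-! ### The law with binomial moments. -/

section

variable {α : ℝ}

theorem kanterVar_one_sub (α : ℝ) : kanterVar (1 - α) = kanterVar α := by
  funext u
  simp only [kanterVar, sub_sub_cancel]
  rw [mul_comm (Real.sin (Real.pi * (1 - α) * u) ^ (1 - α))]

theorem isBinomialMomentLaw_map_kanterVar (h0 : 0 < α) (h1 : α < 1) :
    IsBinomialMomentLaw (1 / α) (unifLaw.map fun u => kanterVar α u ^ (1 / α)) := by
  have hm : Measurable fun u => kanterVar α u ^ (1 / α) := (measurable_kanterVar α).pow_const _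
  refine ⟨Measure.isProbabilityMeasure_map hm.aemeasurable, ?_, fun n => ?_⟩
  · obtain ⟨C, hC⟩ := exists_kanterVar_rpow_le h0 h1
    refine ⟨C, ?_⟩
    rw [ae_map_iff hm.aemeasurable (measurableSet_le (by fun_prop) (by fun_prop))]
    filter_upwards [ae_unifLaw_mem] with u hu
    rw [abs_of_nonneg (Real.rpow_nonneg (kanterVar_nonneg h0 h1 hu) _)]
    exact hC u hu
  · rw [integral_map hm.aemeasurable (by fun_prop), ← integral_kanterVar_rpow h0 h1]
    refine integral_congr_ae ?_
    filter_upwards [ae_unifLaw_mem] with u hu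
    rw [← Real.rpow_mul_natCast (kanterVar_nonneg h0 h1 hu), one_div_mul_eq_div]

theorem IsBinomialMomentLaw.unique {p : ℝ} {μ ν : Measure ℝ} (hμ : IsBinomialMomentLaw p μ)
    (hν : IsBinomialMomentLaw p ν) : μ = ν := by
  have := hμ.isProb
  have := hν.isProb
  obtain ⟨C, hC⟩ := hμ.bounded
  obtain ⟨D, hD⟩ := hν.bounded
  exact Measure.ext_of_moments hC hD fun n => (hμ.moments n).trans (hν.moments n).symm

theorem identDistrib_kanterVar_rpow (h0 : 0 < α) (h1 : α < 1) {μ : Measure ℝ}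
    (hμ : IsBinomialMomentLaw (1 / α) μ) :
    IdentDistrib (kanterVar α) (fun x : ℝ => x ^ α) unifLaw μ := by
  have hm : Measurable fun u => kanterVar α u ^ (1 / α) := (measurable_kanterVar α).pow_const _
  have hp : Measurable fun x : ℝ => x ^ α := by fun_prop
  refine ⟨(measurable_kanterVar α).aemeasurable, hp.aemeasurable, ?_⟩
  rw [hμ.unique (isBinomialMomentLaw_map_kanterVar h0 h1), Measure.map_map hp hm]
  refine Measure.map_congr ?_
  filter_upwards [ae_unifLaw_mem] with u hu
  simp only [Function.comp]
  rw [← Real.rpow_mul (kanterVar_nonneg h0 h1 hu), one_div_mul_cancel h0.ne', Real.rpow_one]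

end

/-! ### Beta moments and Gauss's multiplication formula as rising factorials. -/

theorem ascPochhammer_eval_eq_Gamma_div {a : ℝ} (ha : 0 < a) (m : ℕ) :
    (ascPochhammer ℝ m).eval a = Real.Gamma (a + m) / Real.Gamma a := by
  have h := (Real.Gamma_pos_of_pos ha).ne'
  induction m with
  | zero => simp [h]
  | succ k ih =>
    have hk : (0 : ℝ) ≤ k := k.cast_nonneg
    rw [ascPochhammer_succ_eval, ih, Nat.cast_succ, ← add_assoc,
      Real.Gamma_add_one (s := a + k) (by positivity)]
    ring

theorem integral_betaPDFReal {a b : ℝ} (ha : 0 < a) (hb : 0 < b) :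
    ∫ x, betaPDFReal a b x = 1 := by
  rw [integral_eq_lintegral_of_nonneg_ae _ (by fun_prop)]
  · have := lintegral_betaPDF_eq_one ha hb
    unfold betaPDF at this
    rw [this]
    simp
  · refine Eventually.of_forall fun x => ?_
    by_cases hx : 0 < x ∧ x < 1
    · exact (betaPDFReal_pos hx.1 hx.2 ha hb).le
    · simp [betaPDFReal, hx]

theorem betaPDFReal_mul_pow {a b : ℝ} (ha : 0 < a) (hb : 0 < b) (m : ℕ) (x : ℝ) :
    betaPDFReal a b x * x ^ m = beta (a + m) b / beta a b * betaPDFReal (a + m) b x := by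
  by_cases hx : 0 < x ∧ x < 1
  · have h1 := (beta_pos ha hb).ne'
    have h2 := (beta_pos (α := a + m) (by positivity) hb).ne'
    rw [betaPDFReal, betaPDFReal, if_pos hx, if_pos hx,
      show a + m - 1 = (a - 1) + m by ring, Real.rpow_add hx.1, Real.rpow_natCast]
    field_simp
  · simp [betaPDFReal, hx]

theorem integral_pow_betaMeasure {a b : ℝ} (ha : 0 < a) (hb : 0 < b) (m : ℕ) :
    ∫ x, x ^ m ∂betaMeasure a b = beta (a + m) b / beta a b := by
  have hmeas : Measurable (betaPDF a b) := by
    unfold betaPDF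
    fun_prop
  rw [betaMeasure, integral_withDensity_eq_integral_toReal_smul hmeas
    (Eventually.of_forall fun x => by simp [betaPDF])]
  have : ∀ x, (betaPDF a b x).toReal • x ^ m =
      beta (a + m) b / beta a b * betaPDFReal (a + m) b x := by
    intro x
    rw [← betaPDFReal_mul_pow ha hb, betaPDF, ENNReal.toReal_ofReal, smul_eq_mul]
    by_cases hx : 0 < x ∧ x < 1
    · exact (betaPDFReal_pos hx.1 hx.2 ha hb).le
    · simp [betaPDFReal, hx]
  simp_rw [this]
  rw [MeasureTheory.integral_const_mul, integral_betaPDFReal (by positivity) hb, mul_one]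

theorem isProbabilityMeasure_betaLaw {a b : ℝ} (ha : 0 < a) (hb : 0 ≤ b) :
    IsProbabilityMeasure (betaLaw a b) := by
  unfold betaLaw
  split_ifs with h
  · infer_instance
  · exact isProbabilityMeasureBeta ha (lt_of_le_of_ne hb (Ne.symm h))

theorem ae_abs_le_one_betaLaw (a b : ℝ) : ∀ᵐ x ∂betaLaw a b, |x| ≤ 1 := by
  unfold betaLaw
  split_ifs with h
  · simp
  · rw [betaMeasure, ae_withDensity_iff (by unfold betaPDF; fun_prop)]
    refine Eventually.of_forall fun x hx => ?_
    by_contra h1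
    apply hx
    rcases le_or_gt x 0 with h2 | h2
    · exact betaPDF_eq_zero_of_nonpos h2
    · rw [abs_of_pos h2, not_le] at h1
      exact betaPDF_eq_zero_of_one_le h1.le

theorem integral_pow_betaLaw {a b : ℝ} (ha : 0 < a) (hb : 0 ≤ b) (m : ℕ) :
    ∫ x, x ^ m ∂betaLaw a b =
      (ascPochhammer ℝ m).eval a / (ascPochhammer ℝ m).eval (a + b) := by
  have hab : 0 < a + b := by linarith
  unfold betaLaw
  split_ifs with h
  · rw [h, add_zero, div_self (ascPochhammer_pos m a ha).ne']
    simp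
  · have hb' := lt_of_le_of_ne hb (Ne.symm h)
    have h1 := (Real.Gamma_pos_of_pos ha).ne'
    have h2 := (Real.Gamma_pos_of_pos hb').ne'
    have h3 := (Real.Gamma_pos_of_pos hab).ne'
    have h4 := (Real.Gamma_pos_of_pos (s := a + b + m) (by positivity)).ne'
    rw [integral_pow_betaMeasure ha hb', ascPochhammer_eval_eq_Gamma_div ha,
      ascPochhammer_eval_eq_Gamma_div hab, beta, beta, show a + m + b = a + b + m by ring]
    field_simp

/-- Gauss's multiplication formula for rising factorials. -/
theorem prod_ascPochhammer_eval_div {n : ℕ} (hn : 0 < n) (m : ℕ) :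
    (n : ℝ) ^ (n * m) * ∏ i ∈ Finset.Ico 1 (n + 1), (ascPochhammer ℝ m).eval ((i : ℝ) / n) =
      (n * m).factorial := by
  have hn' : (n : ℝ) ≠ 0 := by positivity
  induction m with
  | zero => simp
  | succ k ih =>
    -- Passing from `k` to `k + 1` multiplies by the `(nk + i) / n`, which are the `n` new factors
    -- of `(n(k + 1))!` up to `n ^ n`.
    have h1 : ∏ i ∈ Finset.Ico 1 (n + 1), ((i : ℝ) / n + k) =
        ((n * k + 1).ascFactorial n : ℝ) / (n : ℝ) ^ n := by
      rw [Finset.prod_Ico_eq_prod_range, Nat.ascFactorial_eq_prod_range, Nat.cast_prod,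
        Nat.add_sub_cancel]
      have : (n : ℝ) ^ n = ∏ _i ∈ Finset.range n, (n : ℝ) := by simp
      rw [this, ← Finset.prod_div_distrib]
      refine Finset.prod_congr rfl fun i _ => ?_
      push_cast
      field_simp
      ring
    simp_rw [ascPochhammer_succ_eval]
    rw [Finset.prod_mul_distrib, h1, mul_add_one, ← Nat.factorial_mul_ascFactorial, Nat.cast_mul,
      ← ih, pow_add]
    field_simp

/-! ### Products over the blocks cut out by an increasing sequence of indices. -/

section

variable {q : ℕ → ℕ} {J : ℕ} {M : Type*} [CommMonoid M]

theorem le_of_strictMono_step (hq : ∀ j < J, q j < q (j + 1)) : ∀ j ≤ J, j ≤ q j := by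
  intro j hj
  induction j with
  | zero => simp
  | succ k ih =>
    have h1 := ih (by omega)
    have h2 := hq k (by omega)
    omega

theorem Finset.Ioo_eq_Ico_succ (a b : ℕ) : Finset.Ioo a b = Finset.Ico (a + 1) b := by
  ext
  simp

theorem prod_Ioo_mul_prod_eq_prod_Ico (F : ℕ → M) (h0 : q 0 = 0)
    (hq : ∀ j < J + 1, q j < q (j + 1)) :
    (∏ j ∈ Finset.range (J + 1), ∏ i ∈ Finset.Ioo (q j) (q (j + 1)), F i) *
      ∏ j ∈ Finset.Ico 1 (J + 1), F (q j) = ∏ i ∈ Finset.Ico 1 (q (J + 1)), F i := by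
  induction J with
  | zero => simp [h0, Finset.Ioo_eq_Ico_succ]
  | succ k ih =>
    have h1 := hq (k + 1) (by omega)
    have h2 := le_of_strictMono_step hq (k + 1) (by omega)
    rw [Finset.prod_range_succ, Finset.prod_Ico_succ_top (b := k + 1) (by omega),
      mul_mul_mul_comm, ih fun j hj => hq j (by omega), Finset.Ioo_eq_Ico_succ,
      mul_comm (∏ i ∈ Finset.Ico (q (k + 1) + 1) _, F i), ← Finset.prod_eq_prod_Ico_succ_bot h1,
      Finset.prod_Ico_consecutive _ (by omega) h1.le]

/-- On block `j` the values `i - j` end at `q (j + 1) - 1 - j`, and the next block starts at `q (j +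
1) - j`: dropping the breakpoints and shifting leaves no gap. -/
theorem prod_Ioo_sub_eq_prod_Ico (G : ℕ → M) (h0 : q 0 = 0) (hq : ∀ j < J, q j < q (j + 1)) :
    ∏ j ∈ Finset.range J, ∏ i ∈ Finset.Ioo (q j) (q (j + 1)), G (i - j) =
      ∏ k ∈ Finset.Ico 1 (q J - J + 1), G k := by
  induction J with
  | zero => simp [h0]
  | succ k ih =>
    have h1 := hq k (by omega)
    have h2 := le_of_strictMono_step hq k (by omega)
    have h3 := Finset.prod_Ico_add_right_sub_eq (f := G) (q k - k + 1) (q (k + 1) - k) k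
    rw [show q k - k + 1 + k = q k + 1 by omega,
      show q (k + 1) - k + k = q (k + 1) by omega] at h3
    rw [Finset.prod_range_succ, ih fun j hj => hq j (by omega), Finset.Ioo_eq_Ico_succ, h3,
      Finset.prod_Ico_consecutive _ (by omega) (by omega)]
    congr 2
    omega

end

/-! ### The indices `q_j`, the Beta product and its moments. -/

section

variable {p n j : ℕ}

theorem qIndex_zero (p n : ℕ) : qIndex p n 0 = 0 := by simp [qIndex]

theorem qIndex_self (hp : 1 ≤ p) (n : ℕ) : qIndex p n p = n := by
  simp [qIndex, Nat.pos_iff_ne_zero.1 hp]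

/-- These bounds make the second Beta parameters nonnegative. Equality on the right, possible when
`p` divides `jn`, is a source of degenerate factors `B_{a,0}`. -/
theorem qIndex_mul_le (hp : 1 ≤ p) (hpn : p < n) (hj : j ≤ p) :
    qIndex p n j * p ≤ j * n ∧ j * n ≤ (qIndex p n j + 1) * p := by
  rcases Nat.eq_zero_or_pos j with rfl | h0
  · simp [qIndex_zero]
  rcases eq_or_lt_of_le hj with rfl | h1
  · rw [qIndex_self hp]
    constructor <;> nlinarith
  have hq : qIndex p n j = sSup {i : ℕ | 1 ≤ i ∧ i * p < j * n} := by
    rw [qIndex, if_neg h0.ne', if_neg h1.ne]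
  have hb : BddAbove {i : ℕ | 1 ≤ i ∧ i * p < j * n} := ⟨j * n, fun i hi => by
    have := hi.2
    nlinarith⟩
  have hmem : qIndex p n j ∈ {i : ℕ | 1 ≤ i ∧ i * p < j * n} := by
    rw [hq]
    -- The index `1` qualifies because `p < n ≤ jn`.
    exact Nat.sSup_mem ⟨1, le_rfl, by nlinarith⟩ hb
  refine ⟨hmem.2.le, ?_⟩
  by_contra! hlt
  have : qIndex p n j + 1 ≤ sSup {i : ℕ | 1 ≤ i ∧ i * p < j * n} :=
    le_csSup hb ⟨by omega, hlt⟩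
  omega

theorem qIndex_lt_succ (hp : 1 ≤ p) (hpn : p < n) (hj : j < p) :
    qIndex p n j < qIndex p n (j + 1) := by
  have h1 := (qIndex_mul_le hp hpn hj.le).1
  have h2 := (qIndex_mul_le (j := j + 1) hp hpn hj).2
  by_contra! h
  have : (qIndex p n (j + 1) + 1) * p ≤ (qIndex p n j + 1) * p :=
    Nat.mul_le_mul_right _ (by omega)
  nlinarith

/-- The numerator parameter of a Beta factor, times `n`. -/
noncomputable def betaIndexNum (p n : ℕ) : BetaIndex p n → ℕ
  | Sum.inl ⟨_, i⟩ => i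
  | Sum.inr j => qIndex p n j

/-- The sum of the two parameters of a Beta factor. -/
noncomputable def betaIndexSum (p n : ℕ) : BetaIndex p n → ℝ
  | Sum.inl ⟨j, i⟩ => (((i : ℕ) - (j : ℕ) : ℕ) : ℝ) / ((n - p : ℕ) : ℝ)
  | Sum.inr j => ((j : ℕ) : ℝ) / p

/-- Ensures that the natural subtraction in `betaIndexSum` does not truncate. -/
theorem le_of_mem_betaIndex (hp : 1 ≤ p) (hpn : p < n) {i : ℕ} (hj : j < p)
    (hi : i ∈ Finset.Ioo (qIndex p n j) (qIndex p n (j + 1))) : j ≤ i := by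
  have h1 := le_of_strictMono_step (q := qIndex p n) (J := p) (fun j hj => qIndex_lt_succ hp hpn hj) j hj.le
  rw [Finset.mem_Ioo] at hi
  omega

theorem betaFactorLaw_eq (hp : 1 ≤ p) (hpn : p < n) (k : BetaIndex p n) :
    betaFactorLaw p n k = betaLaw ((betaIndexNum p n k : ℝ) / n)
      (betaIndexSum p n k - (betaIndexNum p n k : ℝ) / n) := by
  rcases k with ⟨j, i⟩ | j
  · rw [betaFactorLaw, betaIndexSum, betaIndexNum,
      Nat.cast_sub (le_of_mem_betaIndex hp hpn j.2 i.2), Nat.cast_sub hpn.le]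
  · rfl

theorem betaIndexNum_pos (hp : 1 ≤ p) (hpn : p < n) (k : BetaIndex p n) :
    0 < betaIndexNum p n k := by
  rcases k with ⟨j, i⟩ | j
  · have := i.2
    rw [Finset.mem_Ioo] at this
    rw [betaIndexNum]
    omega
  · have h1 := j.2
    rw [Finset.mem_Ico] at h1
    have := le_of_strictMono_step (q := qIndex p n) (J := p) (fun j hj => qIndex_lt_succ hp hpn hj) j h1.2.le
    rw [betaIndexNum]
    omega

theorem betaIndexNum_div_le (hp : 1 ≤ p) (hpn : p < n) (k : BetaIndex p n) :
    (betaIndexNum p n k : ℝ) / n ≤ betaIndexSum p n k := by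
  have hn : (0 : ℝ) < n := by exact_mod_cast (by omega : 0 < n)
  have hp' : (0 : ℝ) < p := by exact_mod_cast hp
  have hpn' : (p : ℝ) < n := by exact_mod_cast hpn
  rcases k with ⟨j, i⟩ | j
  · rw [betaIndexSum, betaIndexNum,
      Nat.cast_sub (le_of_mem_betaIndex hp hpn j.2 i.2), Nat.cast_sub hpn.le,
      div_le_div_iff₀ hn (by linarith)]
    have h1 := (qIndex_mul_le hp hpn j.2.le).2
    have h2 : (qIndex p n j + 1) * p ≤ i * p :=
      Nat.mul_le_mul_right _ (Finset.mem_Ioo.1 i.2).1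
    have h3 : ((j : ℕ) : ℝ) * n ≤ (i : ℕ) * p := by exact_mod_cast h1.trans h2
    linarith
  · rw [betaIndexSum, betaIndexNum, div_le_div_iff₀ hn hp']
    exact_mod_cast (qIndex_mul_le hp hpn (Finset.mem_Ico.1 j.2).2.le).1

theorem isProbabilityMeasure_betaFactorLaw (hp : 1 ≤ p) (hpn : p < n) (k : BetaIndex p n) :
    IsProbabilityMeasure (betaFactorLaw p n k) := by
  have h1 : (0 : ℝ) < betaIndexNum p n k := by exact_mod_cast betaIndexNum_pos hp hpn k
  have h2 : (0 : ℝ) < n := by exact_mod_cast (by omega : 0 < n)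
  rw [betaFactorLaw_eq hp hpn]
  exact isProbabilityMeasure_betaLaw (by positivity)
    (sub_nonneg.2 (betaIndexNum_div_le hp hpn k))

theorem integral_pow_betaFactorLaw (hp : 1 ≤ p) (hpn : p < n) (k : BetaIndex p n) (m : ℕ) :
    ∫ x, x ^ m ∂betaFactorLaw p n k =
      (ascPochhammer ℝ m).eval ((betaIndexNum p n k : ℝ) / n) /
        (ascPochhammer ℝ m).eval (betaIndexSum p n k) := by
  have h1 : (0 : ℝ) < betaIndexNum p n k := by exact_mod_cast betaIndexNum_pos hp hpn k
  have h2 : (0 : ℝ) < n := by exact_mod_cast (by omega : 0 < n)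
  rw [betaFactorLaw_eq hp hpn, integral_pow_betaLaw (by positivity)
    (sub_nonneg.2 (betaIndexNum_div_le hp hpn k)), add_sub_cancel]

theorem prod_betaIndexNum (hp : 1 ≤ p) (hpn : p < n) (F : ℕ → ℝ) :
    ∏ k, F (betaIndexNum p n k) = ∏ i ∈ Finset.Ico 1 n, F i := by
  obtain ⟨J, rfl⟩ : ∃ J, p = J + 1 := ⟨p - 1, by omega⟩
  have h := prod_Ioo_mul_prod_eq_prod_Ico F (qIndex_zero (J + 1) n)
    fun j hj => qIndex_lt_succ hp hpn hj
  rw [qIndex_self hp] at h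
  rw [← h, Fintype.prod_sum_type, Fintype.prod_sigma]
  congr 1
  · rw [← Fin.prod_univ_eq_prod_range
      (fun j => ∏ i ∈ Finset.Ioo (qIndex (J + 1) n j) (qIndex (J + 1) n (j + 1)), F i)]
    exact Finset.prod_congr rfl fun j _ => Finset.prod_coe_sort _ F
  · exact Finset.prod_coe_sort (Finset.Ico 1 (J + 1)) fun j => F (qIndex (J + 1) n j)

theorem prod_betaIndexSum (hp : 1 ≤ p) (hpn : p < n) (F : ℝ → ℝ) :
    ∏ k, F (betaIndexSum p n k) =
      (∏ i ∈ Finset.Ico 1 (n - p + 1), F ((i : ℝ) / ((n - p : ℕ) : ℝ))) *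
        ∏ j ∈ Finset.Ico 1 p, F ((j : ℝ) / p) := by
  have h := prod_Ioo_sub_eq_prod_Ico (fun i => F ((i : ℝ) / ((n - p : ℕ) : ℝ)))
    (qIndex_zero p n) fun j hj => qIndex_lt_succ hp hpn hj
  rw [qIndex_self hp] at h
  rw [← h, Fintype.prod_sum_type, Fintype.prod_sigma]
  congr 1
  · rw [← Fin.prod_univ_eq_prod_range (fun j => ∏ i ∈ Finset.Ioo (qIndex p n j)
      (qIndex p n (j + 1)), F (((i - j : ℕ) : ℝ) / ((n - p : ℕ) : ℝ)))]
    exact Finset.prod_congr rfl fun j _ => Finset.prod_coe_sort _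
      fun i : ℕ => F (((i - j : ℕ) : ℝ) / ((n - p : ℕ) : ℝ))
  · exact Finset.prod_coe_sort (Finset.Ico 1 p) fun j : ℕ => F ((j : ℝ) / p)

/-- The constant `n ^ n / (p ^ p (n - p) ^ (n - p))` times the product of the Beta factors. -/
noncomputable def betaProduct (p n : ℕ) (b : BetaIndex p n → ℝ) : ℝ :=
  (n : ℝ) ^ n / ((p : ℝ) ^ p * ((n : ℝ) - p) ^ (n - p)) * ∏ k, b k

theorem betaProductRoot_eq (p n : ℕ) (b : BetaIndex p n → ℝ) :
    betaProductRoot p n b = betaProduct p n b ^ (1 / (n : ℝ)) := by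
  rw [betaProductRoot, betaProduct, Fintype.prod_sum_type, Fintype.prod_sigma, mul_assoc]

theorem integral_betaProduct_pow (hp : 1 ≤ p) (hpn : p < n) (m : ℕ) :
    ∫ b, betaProduct p n b ^ m ∂betaFactorsJointLaw p n =
      ((n * m).factorial : ℝ) / ((p * m).factorial * ((n - p) * m).factorial) := by
  have := isProbabilityMeasure_betaFactorLaw hp hpn
  have hn : 0 < n := by omega
  have hm : (0 : ℝ) < m.factorial := by positivity
  -- The points `n/n` and `p/p` are absent from the Beta parameters, while `(n-p)/(n-p)` is present.
  -- The two extra factors `m!` split off here cancel in the quotient.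
  have hone : ∀ k : ℕ, 0 < k → ∏ i ∈ Finset.Ico 1 (k + 1),
      (ascPochhammer ℝ m).eval ((i : ℝ) / k) =
        (∏ i ∈ Finset.Ico 1 k, (ascPochhammer ℝ m).eval ((i : ℝ) / k)) * m.factorial := by
    intro k hk
    rw [Finset.prod_Ico_succ_top (by omega), div_self (by positivity), ascPochhammer_eval_one]
  have e1 := prod_ascPochhammer_eval_div hn m
  have e2 := prod_ascPochhammer_eval_div hp m
  have e3 := prod_ascPochhammer_eval_div (n := n - p) (by omega) m
  rw [hone n hn] at e1
  rw [hone p hp] at e2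
  have hcast : (n : ℝ) - p = ((n - p : ℕ) : ℝ) := (Nat.cast_sub hpn.le).symm
  simp_rw [betaProduct, mul_pow, ← Finset.prod_pow]
  rw [MeasureTheory.integral_const_mul, betaFactorsJointLaw,
    integral_fintype_prod_eq_prod (f := fun _ x => x ^ m)]
  simp_rw [integral_pow_betaFactorLaw hp hpn]
  rw [Finset.prod_div_distrib,
    prod_betaIndexSum hp hpn (fun x => (ascPochhammer ℝ m).eval x),
    prod_betaIndexNum hp hpn (fun i => (ascPochhammer ℝ m).eval ((i : ℝ) / n)), hcast,
    ← e1, ← e2, ← e3, div_pow, mul_pow, ← pow_mul, ← pow_mul, ← pow_mul]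
  have hne : ∀ k l : ℕ, 0 < k → ∏ i ∈ Finset.Ico 1 l,
      (ascPochhammer ℝ m).eval ((i : ℝ) / k) ≠ 0 := fun k l hk =>
    Finset.prod_ne_zero_iff.2 fun i hi => (ascPochhammer_pos m _ (by
      have := (Finset.mem_Ico.1 hi).1
      positivity)).ne'
  have h2 := hne p p hp
  have h3 := hne (n - p) (n - p + 1) (by omega)
  have hp' : (p : ℝ) ≠ 0 := by positivity
  have hnp : ((n - p : ℕ) : ℝ) ≠ 0 := by
    have : n - p ≠ 0 := by omega
    exact_mod_cast this
  field_simp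

theorem exists_ae_abs_betaProduct_le (hp : 1 ≤ p) (hpn : p < n) :
    ∃ C : ℝ, ∀ᵐ b ∂betaFactorsJointLaw p n, |betaProduct p n b| ≤ C := by
  have := isProbabilityMeasure_betaFactorLaw hp hpn
  refine ⟨|(n : ℝ) ^ n / ((p : ℝ) ^ p * ((n : ℝ) - p) ^ (n - p))|, ?_⟩
  have hk : ∀ k, ∀ᵐ b ∂betaFactorsJointLaw p n, |b k| ≤ 1 := fun k =>
    (Measure.tendsto_eval_ae_ae (μ := betaFactorLaw p n) (i := k)).eventually (by
      rw [betaFactorLaw_eq hp hpn]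
      exact ae_abs_le_one_betaLaw _ _)
  filter_upwards [ae_all_iff.2 hk] with b hb
  rw [betaProduct, abs_mul, Finset.abs_prod]
  exact mul_le_of_le_one_right (abs_nonneg _)
    (Finset.prod_le_one (fun _ _ => abs_nonneg _) fun k _ => hb k)

/-- Since `nm = pm / (p/n)`, the `m`-th moment of `K ^ n` is the moment of order `pm` of `K ^
(1/α)`. -/
theorem kanterVar_pow_eq (hp : 1 ≤ p) (hpn : p < n) (m : ℕ) (u : ℝ) :
    (kanterVar ((p : ℝ) / n) u ^ n) ^ m =
      kanterVar ((p : ℝ) / n) u ^ (((p * m : ℕ) : ℝ) / ((p : ℝ) / n)) := by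
  have hn : (0 : ℝ) < n := by exact_mod_cast (by omega : 0 < n)
  have hp' : (0 : ℝ) < p := by exact_mod_cast hp
  rw [← pow_mul, ← Real.rpow_natCast]
  congr 1
  push_cast
  field_simp

theorem integral_kanterVar_pow (hp : 1 ≤ p) (hpn : p < n) (m : ℕ) :
    ∫ u, (kanterVar ((p : ℝ) / n) u ^ n) ^ m ∂unifLaw =
      ((n * m).factorial : ℝ) / ((p * m).factorial * ((n - p) * m).factorial) := by
  have hn : (0 : ℝ) < n := by exact_mod_cast (by omega : 0 < n)
  have hp' : (0 : ℝ) < p := by exact_mod_cast hp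
  have h0 : (0 : ℝ) < p / n := by positivity
  have h1 : (p : ℝ) / n < 1 := by
    rw [div_lt_one hn]
    exact_mod_cast hpn
  simp_rw [kanterVar_pow_eq hp hpn m]
  rw [integral_kanterVar_rpow h0 h1, binomialMoment, one_div_div]
  have e1 : 1 + ((p * m : ℕ) : ℝ) * (n / p) = ((n * m : ℕ) : ℝ) + 1 := by
    push_cast
    field_simp
    ring
  have e2 : 1 + ((p * m : ℕ) : ℝ) * (n / p - 1) = (((n - p) * m : ℕ) : ℝ) + 1 := by
    rw [Nat.cast_mul (n - p), Nat.cast_sub hpn.le]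
    push_cast
    field_simp
    ring
  rw [e1, e2, Real.Gamma_nat_eq_factorial, Real.Gamma_nat_eq_factorial,
    mul_comm (Nat.cast _ : ℝ)]

/-- The `n`-th powers have explicit moments, so they are compared first; the root then recovers `K`,
which is almost surely nonnegative. -/
theorem identDistrib_kanterVar_betaProductRoot (hp : 1 ≤ p) (hpn : p < n) :
    IdentDistrib (kanterVar ((p : ℝ) / n)) (betaProductRoot p n)
      unifLaw (betaFactorsJointLaw p n) := by
  have hn : (0 : ℝ) < n := by exact_mod_cast (by omega : 0 < n)
  have hp' : (0 : ℝ) < p := by exact_mod_cast hp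
  have h0 : (0 : ℝ) < p / n := by positivity
  have h1 : (p : ℝ) / n < 1 := by
    rw [div_lt_one hn]
    exact_mod_cast hpn
  have := isProbabilityMeasure_betaFactorLaw hp hpn
  have : IsProbabilityMeasure (betaFactorsJointLaw p n) := by
    unfold betaFactorsJointLaw
    infer_instance
  have hX : Measurable fun u => kanterVar ((p : ℝ) / n) u ^ n :=
    (measurable_kanterVar _).pow_const _
  have hY : Measurable (betaProduct p n) := by
    unfold betaProduct
    fun_prop
  obtain ⟨C, hC⟩ := exists_kanterVar_rpow_le h0 h1
  obtain ⟨D, hD⟩ := exists_ae_abs_betaProduct_le hp hpn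
  have hC' : ∀ᵐ u ∂unifLaw, |kanterVar ((p : ℝ) / n) u ^ n| ≤ C ^ p := by
    filter_upwards [ae_unifLaw_mem] with u hu
    have hK := kanterVar_nonneg h0 h1 hu
    have := kanterVar_pow_eq hp hpn 1 u
    rw [pow_one, mul_one] at this
    rw [this, abs_of_nonneg (Real.rpow_nonneg hK _),
      ← one_div_mul_eq_div ((p : ℝ) / n) (p : ℝ),
      Real.rpow_mul_natCast hK]
    exact pow_le_pow_left₀ (Real.rpow_nonneg hK _) (hC u hu) _
  have hid := identDistrib_of_moments hX hY hC' hD fun m =>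
    (integral_kanterVar_pow hp hpn m).trans (integral_betaProduct_pow hp hpn m).symm
  have hroot := hid.comp (u := fun x : ℝ => x ^ (1 / (n : ℝ))) (by fun_prop)
  have hY' : (fun x : ℝ => x ^ (1 / (n : ℝ))) ∘ betaProduct p n = betaProductRoot p n :=
    funext fun b => (betaProductRoot_eq p n b).symm
  rw [hY'] at hroot
  refine (IdentDistrib.of_ae_eq (measurable_kanterVar _).aemeasurable ?_).trans hroot
  filter_upwards [ae_unifLaw_mem] with u hu
  simp only [Function.comp]
  rw [one_div, Real.pow_rpow_inv_natCast (kanterVar_nonneg h0 h1 hu) (by omega)]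

end

end

theorem proposition2 :
    (∀ α : ℝ, 0 < α → α < 1 →
      IdentDistrib (kanterVar α) (kanterVar (1 - α)) unifLaw unifLaw ∧
      (∃! μ : Measure ℝ, IsBinomialMomentLaw (1 / α) μ) ∧
      ∀ μ : Measure ℝ, IsBinomialMomentLaw (1 / α) μ →
        IdentDistrib (kanterVar (1 - α)) (fun x : ℝ => x ^ α) unifLaw μ) ∧
    (∀ p n : ℕ, 1 ≤ p → p < n →
      IdentDistrib (kanterVar ((p : ℝ) / n)) (betaProductRoot p n)
        unifLaw (betaFactorsJointLaw p n)) := by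
  refine ⟨fun α h0 h1 => ⟨?_, ?_, fun μ hμ => ?_⟩, fun p n hp hpn =>
    identDistrib_kanterVar_betaProductRoot hp hpn⟩
  · rw [kanterVar_one_sub]
    exact IdentDistrib.refl (measurable_kanterVar α).aemeasurable
  · exact ⟨_, isBinomialMomentLaw_map_kanterVar h0 h1, fun ν hν =>
      hν.unique (isBinomialMomentLaw_map_kanterVar h0 h1)⟩
  · rw [kanterVar_one_sub]
    exact identDistrib_kanterVar_rpow h0 h1 hμ
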